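/- \textbf{Theorem (Nash's existence theorem for non-compact strategy sets).} For $i=1,\dots,n$ let $K_i$ be a nonempty convex subset of a real reflexive Banach space $E_i$. Put $X := K_1\times\cdots\times K_n \subseteq E := E_1\times\cdots\times E_n$, where $E$ carries the norm $\|p\|_E := \sqrt{\sum_{i=1}^n \|p_i\|_{E_i}^2}$, and let $f_i\colon X\to\mathbb{R}$ be the loss of player $i$. A functional $g\colon X\to\mathbb{R}$ is called weakly lower semicontinuous on $X$ if for every $l\in\mathbb{R}$ the set $\{q\in X : g(q)\le l\}$ is weakly closed in $E$, and weakly continuous on $X$ if both $g$ and $-g$ are weakly lower semicontinuous on $X$ (equivalently, $X$ is weakly closed in $E$ and $g$ is continuous for the weak topology restricted to $X$). Assume: \begin{enumerate} \item[(I)] for each $i$ and all fixed components $p_j\in K_j$, $j\ne i$, the functional $p_i\mapsto f_i(p_1,\dots,p_n)$ is convex on $K_i$; \item[(II)] each $f_i$ is weakly continuous on $X$; \item[(III)] there exists $p_0=(p_{10},\dots,p_{n0})\in X$ such that the set \[ \Bigl\{q\in X : \sum_{i=1}^n\bigl[f_i(q)-f_i(q_1,\dots,q_{i-1},p_{i0},q_{i+1},\dots,q_n)\bigr]\le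 0\Bigr\} \] is bounded in $E$. \end{enumerate} Then there is at least one Nash equilibrium in $X$, that is, a point $\tilde q\in X$ such that, for every $i=1,\dots,n$, \[ f_i(\tilde q)=\min_{p_i\in K_i} f_i(\tilde q_1,\dots,\tilde q_{i-1},p_i,\tilde q_{i+1},\dots,\tilde q_n). \] -/

import Mathlib

/-- A real normed space is reflexive when the canonical map into its bidual is onto. -/
def IsReflexiveSpace (E : Type*) [NormedAddCommGroup E] [NormedSpace ℝ E] : Prop :=
  Function.Surjective (NormedSpace.inclusionInDoubleDual ℝ E)

/-- `S` is closed in `E` for the weak topology. -/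
def IsWeaklyClosed {E : Type*} [NormedAddCommGroup E] [NormedSpace ℝ E] (S : Set E) : Prop :=
  IsClosed (toWeakSpace ℝ E '' S)

/-- Weak lower semicontinuity on `X ⊆ E`: for every level `l`, the set
`{y ∈ X | g y ≤ l}` is weakly closed (in the whole space `E`). -/
def WeaklyLowerSemicontinuousOn {E : Type*} [NormedAddCommGroup E] [NormedSpace ℝ E]
    (g : E → ℝ) (X : Set E) : Prop :=
  ∀ l : ℝ, IsWeaklyClosed {y : E | y ∈ X ∧ g y ≤ l}

/-- Weak continuity on `X`: both `g` and `-g` are weakly lower semicontinuous on `X`. -/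
def WeaklyContinuousOn {E : Type*} [NormedAddCommGroup E] [NormedSpace ℝ E]
    (g : E → ℝ) (X : Set E) : Prop :=
  WeaklyLowerSemicontinuousOn g X ∧ WeaklyLowerSemicontinuousOn (fun y => -g y) X

/-- The set `X = K₁ × ⋯ × Kₙ` of strategy profiles, inside the product space
`E = E₁ × ⋯ × Eₙ` with norm `‖p‖ = √(∑ i, ‖p i‖ ^ 2)`. -/
def strategyProfiles {n : ℕ} {E : Fin n → Type*} (K : ∀ i, Set (E i)) : Set (PiLp 2 E) :=
  {p | ∀ i, p i ∈ K i}

/-- The profile `(q₁, …, qᵢ₋₁, x, qᵢ₊₁, …, qₙ)`. -/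
def deviate {n : ℕ} {E : Fin n → Type*} (q : PiLp 2 E) (i : Fin n) (x : E i) : PiLp 2 E :=
  WithLp.toLp 2 (Function.update (fun j => q j) i x)

/-- `q ∈ X` is a Nash equilibrium for the losses `f i`:
`f i q = min_{x ∈ K i} f i (q₁, …, qᵢ₋₁, x, qᵢ₊₁, …, qₙ)` for every player `i`. -/
def IsNashEquilibrium {n : ℕ} {E : Fin n → Type*} (K : ∀ i, Set (E i))
    (f : Fin n → PiLp 2 E → ℝ) (q : PiLp 2 E) : Prop :=
  q ∈ strategyProfiles K ∧
    ∀ i, IsLeast ((fun x : E i => f i (deviate q i x)) '' K i) (f i q)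

/-! The Nikaido–Isoda function `φ q p` adds up the gains of the players when each deviates alone
from `q` to its own coordinate of `p`. It vanishes for `p = q`, is concave in `p` because each loss
is convex in the player's own strategy, and is weakly continuous in `q`. A profile `q` with `φ q p ≤
0` for all `p` is an equilibrium: let `p` differ from `q` in one coordinate only.

Such a `q` comes from Ky Fan's inequality in the weak topology
(`exists_forall_nonpos_of_isCompact`). Reflexivity and the boundedness assumption make `{φ · p₀ ≤
0}` weakly compact, so finitely many `p` at a time suffice, and restricting `q` to their convex hull
leaves a question on a simplex.

There a Brouwer-type statement is needed (`exists_forall_nonneg_of_stdSimplex`). Its source is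
Scarf's lemma, a parity count of dominant sets: on the integer points of a fine simplex it yields
nearby points of every colour, apart from colours whose face is near, and compactness gives the
limit. -/

/-! ### Combinatorics: dominant sets and Scarf's lemma. -/

section Scarf

variable {V I L : Type*} [LinearOrder L]

/-- A finite set `S` is dominant for the rankings `r i` when every `y` is, for some `i`, ranked
at most as high as all members of `S`. -/
def Dominant (r : I → V → L) (S : Finset V) : Prop :=
  ∀ y, ∃ i, ∀ s ∈ S, r i y ≤ r i s

theorem Dominant.mono {r : I → V → L} {S T : Finset V} (h : Dominant r T) (hST : S ⊆ T) :
    Dominant r S := fun y => (h y).imp fun _ hi s hs => hi s (hST hs)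

/-- `y` beats the minimum of `S` in every ranking other than the `k`-th. -/
def BeatsExcept (r : I → V → L) (S : Finset V) (k : I) (y : V) : Prop :=
  ∀ l, l ≠ k → ∃ s ∈ S, r l s < r l y

/-- `x` is the `k`-best element among those satisfying `BeatsExcept r S k`. -/
def IsBestExcept (r : I → V → L) (S : Finset V) (k : I) (x : V) : Prop :=
  BeatsExcept r S k x ∧ ∀ y, BeatsExcept r S k y → r k y ≤ r k x

theorem exists_isBestExcept [Finite V] {r : I → V → L} {S : Finset V} {k : I}
    (h : ∃ y, BeatsExcept r S k y) : ∃ x, IsBestExcept r S k x := by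
  obtain ⟨x, hx, hmax⟩ := Set.exists_max_image {y | BeatsExcept r S k y} (r k) (Set.toFinite _) h
  exact ⟨x, hx, hmax⟩

theorem IsBestExcept.unique {r : I → V → L} (hr : ∀ i, Function.Injective (r i)) {S : Finset V}
    {k : I} {x y : V} (hx : IsBestExcept r S k x) (hy : IsBestExcept r S k y) : x = y :=
  hr k (le_antisymm (hy.2 x hx.1) (hx.2 y hy.1))

/-- In a dominant set with one element fewer than there are rankings, exactly two rankings share
their minimiser, so there are exactly two candidates for dominant one-point extensions. -/
theorem Dominant.exists_pair [Fintype I] [DecidableEq V] {r : I → V → L}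
    (hr : ∀ i, Function.Injective (r i)) {S : Finset V} (hS : Dominant r S) (hne : S.Nonempty)
    (hcard : S.card + 1 = Fintype.card I) :
    ∃ i j, i ≠ j ∧
      (∀ x, (x ∉ S ∧ Dominant r (insert x S)) ↔ IsBestExcept r S i x ∨ IsBestExcept r S j x) ∧
      ∀ x, IsBestExcept r S i x → ¬ IsBestExcept r S j x := by
  classical
  have hmin : ∀ l, ∃ s ∈ S, ∀ s' ∈ S, r l s ≤ r l s' := fun l => S.exists_min_image (r l) hne
  choose m hmS hm using hmin
  have hsurj : ∀ s ∈ S, ∃ l, m l = s := fun s hs => by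
    obtain ⟨l, hl⟩ := hS s
    exact ⟨l, hr l (le_antisymm (hm l s hs) (hl _ (hmS l)))⟩
  obtain ⟨i, -, j, -, hij, hmij⟩ := Finset.exists_ne_map_eq_of_card_lt_of_maps_to
    (s := (Finset.univ : Finset I)) (t := S) (f := m)
    (by rw [Finset.card_univ]; omega) (fun l _ => hmS l)
  -- `m` maps onto `S`, which has one element fewer than `I`, so `{i, j}` is its only fibre with
  -- more than one element.
  have honly : ∀ k, k ≠ i → k ≠ j → ∀ l, l ≠ k → m l ≠ m k := by
    intro k hki hkj l hlk hml
    have hsub : S ⊆ ((Finset.univ.erase k).erase i).image m := by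
      intro s hs
      obtain ⟨a, rfl⟩ := hsurj s hs
      have hj : m i ∈ ((Finset.univ.erase k).erase i).image m :=
        Finset.mem_image.2 ⟨j, by simp [hij.symm, hkj.symm], hmij.symm⟩
      by_cases hai : a = i
      · rwa [hai]
      by_cases hak : a = k
      · rw [hak, ← hml]
        by_cases hli : l = i
        · rwa [hli]
        · exact Finset.mem_image_of_mem _ (by simp [hli, hlk])
      · exact Finset.mem_image_of_mem _ (by simp [hai, hak])
    have h1 := (Finset.card_le_card hsub).trans Finset.card_image_le
    rw [Finset.card_erase_of_mem (by simp [hki.symm]), Finset.card_erase_of_mem (by simp),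
      Finset.card_univ] at h1
    have := hne.card_pos
    omega
  -- the candidates do extend
  have hext : ∀ a b, a ≠ b → m a = m b →
      ∀ x, IsBestExcept r S a x → x ∉ S ∧ Dominant r (insert x S) := by
    intro a b hab hmab x hx
    have hxlt : ∀ l, l ≠ a → r l (m l) < r l x := fun l hl => by
      obtain ⟨s, hs, hlt⟩ := hx.1 l hl
      exact (hm l s hs).trans_lt hlt
    have hxS : x ∉ S := by
      intro hxS
      obtain ⟨l, hl⟩ := hsurj x hxS
      by_cases hla : l = a
      · have := hxlt b hab.symm
        rw [← hmab, ← hla, hl] at this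
        exact lt_irrefl _ this
      · have := hxlt l hla
        rw [hl] at this
        exact lt_irrefl _ this
    have hxa : ∀ s ∈ S, r a x ≤ r a s := by
      obtain ⟨l, hl⟩ := hS x
      by_cases hla : l = a
      · rwa [hla] at hl
      · exact absurd (hl _ (hmS l)) (not_le.2 (hxlt l hla))
    refine ⟨hxS, fun y => ?_⟩
    by_cases hy : BeatsExcept r S a y
    · refine ⟨a, fun s hs => ?_⟩
      rcases Finset.mem_insert.1 hs with rfl | hs
      · exact hx.2 y hy
      · exact (hx.2 y hy).trans (hxa s hs)
    · simp only [BeatsExcept, not_forall, not_exists, not_and, not_lt] at hy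
      obtain ⟨l, hl, hle⟩ := hy
      refine ⟨l, fun s hs => ?_⟩
      rcases Finset.mem_insert.1 hs with rfl | hs
      · exact (hle _ (hmS l)).trans (hxlt l hl).le
      · exact hle s hs
  refine ⟨i, j, hij, fun x => ⟨fun ⟨hxS, hx⟩ => ?_, ?_⟩, fun x hxi hxj => ?_⟩
  -- Dominance at `x` itself makes `x` the `k`-minimum of the enlarged set. Every member of `S` must
  -- then be the minimiser of some ranking other than `k`, which puts `k` in the double fibre.
  · obtain ⟨k, hk⟩ := hx x
    have hne_k : ∀ s ∈ S, ∃ l, l ≠ k ∧ m l = s ∧ r l s ≤ r l x := by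
      intro s hs
      obtain ⟨l, hl⟩ := hx s
      refine ⟨l, ?_, hr l (le_antisymm (hm l s hs)
        (hl _ (Finset.mem_insert_of_mem (hmS l)))), hl x (Finset.mem_insert_self _ _)⟩
      rintro rfl
      have : s = x := hr l (le_antisymm (hl x (Finset.mem_insert_self _ _))
        (hk s (Finset.mem_insert_of_mem hs)))
      exact hxS (this ▸ hs)
    have hkij : k = i ∨ k = j := by
      by_contra hcon
      push Not at hcon
      obtain ⟨l, hl, hml, -⟩ := hne_k (m k) (hmS k)
      exact honly k hcon.1 hcon.2 l hl hml
    have hbest : IsBestExcept r S k x := by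
      refine ⟨fun l hl => ?_, fun y hy => ?_⟩
      · obtain ⟨l', hl', hml', hle⟩ := hne_k (m l) (hmS l)
        have hll : l' = l ∨ r l (m l) < r l x := by
          by_contra hcon
          push Not at hcon
          obtain ⟨hne', hle'⟩ := hcon
          have hl_ij : l = i ∨ l = j := by
            by_contra hc
            push Not at hc
            exact honly l hc.1 hc.2 l' hne' hml'
          have hl'_ij : l' = i ∨ l' = j := by
            by_contra hc
            push Not at hc
            exact honly l' hc.1 hc.2 l hne'.symm hml'.symm
          rcases hkij with rfl | rfl <;> rcases hl_ij with rfl | rfl <;>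
            rcases hl'_ij with rfl | rfl <;> simp_all
        rcases hll with rfl | hlt
        · refine ⟨m l', hmS l', lt_of_le_of_ne hle fun he => hxS ?_⟩
          rw [← hr l' he]
          exact hmS l'
        · exact ⟨m l, hmS l, hlt⟩
      · obtain ⟨l, hl⟩ := hx y
        by_cases hlk : l = k
        · rw [← hlk]
          exact hl x (Finset.mem_insert_self _ _)
        · obtain ⟨s, hs, hlt⟩ := hy l hlk
          exact absurd (hl s (Finset.mem_insert_of_mem hs)) (not_le.2 hlt)
    rcases hkij with rfl | rfl
    · exact Or.inl hbest
    · exact Or.inr hbest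
  · rintro (h | h)
    · exact hext i j hij hmij x h
    · exact hext j i hij.symm hmij.symm x h
  -- A common best element would beat the minimum of `S` in every ranking, against dominance of `S`
  -- at `x`.
  · obtain ⟨l, hl⟩ := hS x
    by_cases hli : l = i
    · obtain ⟨s, hs, hlt⟩ := hxj.1 l (hli ▸ hij)
      exact absurd (hl s hs) (not_le.2 hlt)
    · obtain ⟨s, hs, hlt⟩ := hxi.1 l hli
      exact absurd (hl s hs) (not_le.2 hlt)

/-- If every ranking admits a candidate, a dominant set with one element fewer than there are
rankings has exactly two dominant one-point extensions. -/
theorem Dominant.card_extensions [Fintype I] [Fintype V] [DecidableEq V] {r : I → V → L}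
    [DecidablePred (Dominant r)]
    (hr : ∀ i, Function.Injective (r i)) {S : Finset V} (hS : Dominant r S) (hne : S.Nonempty)
    (hcard : S.card + 1 = Fintype.card I) (hbeat : ∀ k, ∃ y, BeatsExcept r S k y) :
    (Finset.univ.filter fun x => x ∉ S ∧ Dominant r (insert x S)).card = 2 := by
  obtain ⟨i, j, -, hiff, hdisj⟩ := hS.exists_pair hr hne hcard
  obtain ⟨x, hx⟩ := exists_isBestExcept (hbeat i)
  obtain ⟨y, hy⟩ := exists_isBestExcept (hbeat j)
  rw [Finset.card_eq_two]
  refine ⟨x, y, fun h => hdisj x hx (h ▸ hy), ?_⟩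
  ext z
  simp only [Finset.mem_filter, Finset.mem_univ, true_and, hiff, Finset.mem_insert,
    Finset.mem_singleton]
  constructor
  · rintro (h | h)
    · exact Or.inl (h.unique hr hx)
    · exact Or.inr (h.unique hr hy)
  · rintro (rfl | rfl)
    · exact Or.inl hx
    · exact Or.inr hy

/-- A set with as many elements as there are colours, not exhibiting all colours, has an even
number of points whose removal leaves exactly the colours other than `a`. -/
theorem even_card_removals [Fintype I] [DecidableEq I] [DecidableEq V] (c : V → I) (a : I)
    {R : Finset V} (hcard : R.card = Fintype.card I) (hR : R.image c ≠ Finset.univ) :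
    Even (R.filter fun x => (R.erase x).image c = Finset.univ.erase a).card := by
  rcases (R.filter fun x => (R.erase x).image c = Finset.univ.erase a).eq_empty_or_nonempty with
    h | ⟨x, hx⟩
  · simp [h]
  -- Such a removal leaves as many points as colours, so `c` is injective on the rest. Hence the
  -- removed point shares its colour with exactly one other point, and these two are the only
  -- possible removals.
  have hinj : ∀ z ∈ R, (R.erase z).image c = Finset.univ.erase a →
      Set.InjOn c (R.erase z : Finset V) := by
    intro z hz h
    rw [← Finset.card_image_iff, h, Finset.card_erase_of_mem hz,
      Finset.card_erase_of_mem (Finset.mem_univ _), hcard, Finset.card_univ]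
  obtain ⟨hxR, hximg⟩ := Finset.mem_filter.1 hx
  have hcx : c x ≠ a := by
    intro h
    apply hR
    rw [← Finset.insert_erase hxR, Finset.image_insert, hximg, h,
      Finset.insert_erase (Finset.mem_univ _)]
  obtain ⟨y, hy, hcy⟩ : ∃ y ∈ R.erase x, c y = c x := by
    rw [← Finset.mem_image, hximg]
    simp [hcx]
  obtain ⟨hyx, hyR⟩ := Finset.mem_erase.1 hy
  have hyimg : (R.erase y).image c = Finset.univ.erase a := by
    rw [← hximg]
    have hx' : x ∈ R.erase y := by simp [hxR, hyx.symm]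
    rw [← Finset.insert_erase hx', ← Finset.insert_erase hy, Finset.image_insert,
      Finset.image_insert, hcy, Finset.erase_right_comm]
  have : (R.filter fun x => (R.erase x).image c = Finset.univ.erase a) = {x, y} := by
    ext z
    simp only [Finset.mem_filter, Finset.mem_insert, Finset.mem_singleton]
    constructor
    · rintro ⟨hz, hzimg⟩
      by_contra hcon
      push Not at hcon
      exact hyx (hinj z hz hzimg (by simp [hyR, hcon.2.symm]) (by simp [hxR, hcon.1.symm]) hcy)
    · rintro (rfl | rfl)
      · exact ⟨hxR, hximg⟩
      · exact ⟨hyR, hyimg⟩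
  rw [this, Finset.card_pair hyx.symm]
  exact even_two

/-- Double counting of pairs (set, one-point extension). -/
theorem sum_card_extensions_eq [Fintype V] [DecidableEq V] (P Q : Finset V → Prop)
    [DecidablePred P] [DecidablePred Q] :
    ∑ D with Q D, (Finset.univ.filter fun x => x ∉ D ∧ P (insert x D)).card =
      ∑ R with P R, (R.filter fun x => Q (R.erase x)).card := by
  rw [← Finset.card_sigma, ← Finset.card_sigma]
  refine Finset.card_nbij' (fun p => ⟨insert p.2 p.1, p.2⟩) (fun p => ⟨p.1.erase p.2, p.2⟩)
    ?_ ?_ ?_ ?_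
  · rintro ⟨D, x⟩ h
    simp_all
  · rintro ⟨R, x⟩ h
    simp_all [Finset.insert_erase]
  · rintro ⟨D, x⟩ h
    simp_all
  · rintro ⟨R, x⟩ h
    simp_all [Finset.insert_erase]

/-- **Scarf's lemma**: for rankings of `T ⊕ I` in which the slack element `inr i` is the worst for
`i` and better than all of `T` for everyone else, every colouring of `T` by `I`, extended by
`inr i ↦ i`, has a dominant set exhibiting every colour. -/
theorem exists_dominant_image_eq_univ {T : Type*} [Fintype T] [Nonempty T] [Fintype I]
    [Nonempty I] [DecidableEq I] [DecidableEq T] (r : I → T ⊕ I → L)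
    (hr : ∀ i, Function.Injective (r i))
    (hworst : ∀ i v, r i (Sum.inr i) ≤ r i v)
    (hslack : ∀ i j t, j ≠ i → r i (Sum.inl t) < r i (Sum.inr j)) (c : T → I) :
    ∃ R : Finset (T ⊕ I), Dominant r R ∧ R.image (Sum.elim c id) = Finset.univ := by
  classical
  by_contra hcon
  push Not at hcon
  obtain ⟨a⟩ := ‹Nonempty I›
  have hlt : ∀ i t, r i (Sum.inr i) < r i (Sum.inl t) := fun i t =>
    lt_of_le_of_ne (hworst i _) fun h => by simpa using hr i h
  -- Count the pairs `D = R.erase x` with `Q D` and `P R`. Each `R` contributes an even number,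
  -- since it misses a colour; each `D` contributes two, except the all-slack `D₀`, which
  -- contributes one.
  let P : Finset (T ⊕ I) → Prop := fun R => Dominant r R ∧ R.card = Fintype.card I
  let Q : Finset (T ⊕ I) → Prop := fun D => Dominant r D ∧ D.card + 1 = Fintype.card I ∧
    D.image (Sum.elim c id) = Finset.univ.erase a
  have hsum := sum_card_extensions_eq P Q
  have hright : Even (∑ R with P R, (R.filter fun x => Q (R.erase x)).card) := by
    refine Finset.even_sum _ fun R hR => ?_
    obtain ⟨hRd, hRc⟩ := (Finset.mem_filter.1 hR).2
    have h := even_card_removals (Sum.elim c id) a hRc (hcon R hRd)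
    rwa [Finset.filter_congr fun x hx => (⟨fun h => h.2.2, fun h =>
      ⟨hRd.mono (Finset.erase_subset _ _), by rw [Finset.card_erase_add_one hx, hRc], h⟩⟩ :
        Q (R.erase x) ↔ (R.erase x).image (Sum.elim c id) = Finset.univ.erase a)]
  let D₀ : Finset (T ⊕ I) := (Finset.univ.erase a).image Sum.inr
  have hD₀mem : ∀ j, Sum.inr j ∈ D₀ ↔ j ≠ a := fun j => by simp [D₀]
  have hD₀dom : Dominant r D₀ := by
    rintro (t | j)
    · refine ⟨a, fun s hs => ?_⟩
      obtain ⟨j, hj, rfl⟩ := Finset.mem_image.1 hs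
      exact (hslack a j t (Finset.ne_of_mem_erase hj)).le
    · exact ⟨j, fun s _ => hworst j s⟩
  have hD₀card : D₀.card + 1 = Fintype.card I := by
    rw [Finset.card_image_of_injective _ Sum.inr_injective,
      Finset.card_erase_add_one (Finset.mem_univ _), Finset.card_univ]
  have hQ₀ : Q D₀ := by
    refine ⟨hD₀dom, hD₀card, ?_⟩
    ext j
    simp [D₀]
  have hleft₀ : (Finset.univ.filter fun x => x ∉ D₀ ∧ P (insert x D₀)).card = 1 := by
    obtain ⟨t₀, ht₀⟩ := Finite.exists_max (fun t => r a (Sum.inl t))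
    rw [Finset.card_eq_one]
    refine ⟨Sum.inl t₀, ?_⟩
    ext x
    simp only [Finset.mem_filter, Finset.mem_univ, true_and, Finset.mem_singleton]
    constructor
    · rintro ⟨hx, hdom, -⟩
      -- Every slack in `D₀` lies below `t₀` in its own ranking, so only ranking `a` can witness
      -- dominance at `t₀`; the added element must then be the `a`-best of `T`.
      obtain ⟨i, hi⟩ := hdom (Sum.inl t₀)
      have hia : i = a := by
        by_contra hia
        exact absurd (hi (Sum.inr i) (Finset.mem_insert_of_mem ((hD₀mem i).2 hia)))
          (not_le.2 (hlt i t₀))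
      subst hia
      have hle := hi x (Finset.mem_insert_self _ _)
      rcases x with t | j
      · exact hr i (le_antisymm (ht₀ t) hle)
      · have : j = i := by
          by_contra hj
          exact hx ((hD₀mem j).2 hj)
        subst this
        exact absurd hle (not_le.2 (hlt j t₀))
    · rintro rfl
      have hnot : Sum.inl t₀ ∉ D₀ := by simp [D₀]
      refine ⟨hnot, ?_, by rw [Finset.card_insert_of_notMem hnot, hD₀card]⟩
      rintro (t | j)
      · refine ⟨a, fun s hs => ?_⟩
        rcases Finset.mem_insert.1 hs with rfl | hs
        · exact ht₀ t
        · obtain ⟨j, hj, rfl⟩ := Finset.mem_image.1 hs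
          exact (hslack a j t (Finset.ne_of_mem_erase hj)).le
      · exact ⟨j, fun s _ => hworst j s⟩
  have hleft : ∀ D, Q D → D ≠ D₀ →
      (Finset.univ.filter fun x => x ∉ D ∧ P (insert x D)).card = 2 := by
    rintro D ⟨hdom, hcard, himg⟩ hne
    -- A set of slacks alone is determined by its colours, hence is `D₀`. A member from `T` makes
    -- `inr k` a candidate for each ranking `k`, so neither of the two extensions is lost.
    obtain ⟨t, ht⟩ : ∃ t, Sum.inl t ∈ D := by
      by_contra hno
      push Not at hno
      apply hne
      ext x
      rcases x with t | j
      · simp [D₀, hno t]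
      · rw [hD₀mem]
        have : j ∈ D.image (Sum.elim c id) ↔ Sum.inr j ∈ D := by
          simp only [Finset.mem_image]
          constructor
          · rintro ⟨t | k, h, hk⟩
            · exact absurd h (hno t)
            · simp only [Sum.elim_inr, id] at hk
              exact hk ▸ h
          · exact fun h => ⟨_, h, rfl⟩
        rw [← this, himg]
        simp
    rw [← hdom.card_extensions hr ⟨_, ht⟩ hcard
      fun k => ⟨Sum.inr k, fun l hl => ⟨_, ht, hslack l k t hl.symm⟩⟩]
    congr 1
    ext x
    simp only [Finset.mem_filter, Finset.mem_univ, true_and, P]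
    refine and_congr_right fun hx => ⟨fun h => h.1, fun h => ⟨h, ?_⟩⟩
    rw [Finset.card_insert_of_notMem hx, hcard]
  have hodd : Odd (∑ D with Q D,
      (Finset.univ.filter fun x => x ∉ D ∧ P (insert x D)).card) := by
    rw [← Finset.add_sum_erase _ _ (Finset.mem_filter.2 ⟨Finset.mem_univ D₀, hQ₀⟩), hleft₀]
    refine Odd.add_even odd_one (Finset.even_sum _ fun D hD => ?_)
    rw [hleft D (Finset.mem_filter.1 (Finset.mem_of_mem_erase hD)).2 (Finset.ne_of_mem_erase hD)]
    exact even_two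
  rw [hsum] at hodd
  exact (Nat.not_even_iff_odd.2 hodd) hright

end Scarf

/-! ### From Scarf's lemma to Brouwer-type statements on the simplex. -/

section Sperner

/-- A discrete form of Brouwer's theorem: for every colouring of the integer points of the simplex
of size `N`, some point is close to points of every colour `i`, unless it is close to the
`i`-th face. -/
theorem exists_near_all_colours {I : Type*} [Fintype I] [Nonempty I] (N : ℕ) (c : (I → ℕ) → I) :
    ∃ x₀ : I → ℕ, ∑ i, x₀ i = N ∧ ∀ i, (∃ x : I → ℕ, ∑ i, x i = N ∧ c x = i ∧
      ∀ j, x j < x₀ j + Fintype.card I ∧ x₀ j < x j + Fintype.card I) ∨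
        x₀ i < Fintype.card I := by
  classical
  obtain ⟨i₀⟩ := ‹Nonempty I›
  let T := {x : I → ℕ // x ∈ Finset.univ.piAntidiag N}
  have hT : ∀ x : I → ℕ, ∑ i, x i = N → x ∈ (Finset.univ : Finset I).piAntidiag N :=
    fun x hx => Finset.mem_piAntidiag.2 ⟨hx, fun i _ => Finset.mem_univ i⟩
  have hTsum : ∀ t : T, ∑ i, t.1 i = N := fun t => (Finset.mem_piAntidiag.1 t.2).1
  have t₀ : T := ⟨Pi.single i₀ N, hT _ (by simp)⟩
  have : Nonempty T := ⟨t₀⟩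
  let _ : Fintype T := Finset.Subtype.fintype _
  let e := Fintype.equivFin T
  let eI := Fintype.equivFin I
  let M := Fintype.card T
  -- Points are ranked by their `i`-th coordinate, ties being broken by `e`. Coordinates are at most
  -- `N`, so the offset `(N + 1) * M` lifts the other slacks above all points; `1 +` reserves `0`
  -- for the slack `i`.
  let r : I → T ⊕ I → ℕ := fun i => Sum.elim (fun t => 1 + (t.1 i * M + e t))
    (fun j => if j = i then 0 else 1 + ((N + 1) * M + eI j))
  have hinl : ∀ i t, r i (Sum.inl t) = 1 + (t.1 i * M + e t) := fun _ _ => rfl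
  have hinr : ∀ i j, r i (Sum.inr j) = if j = i then 0 else 1 + ((N + 1) * M + eI j) :=
    fun _ _ => rfl
  have he : ∀ t, (e t : ℕ) < M := fun t => (e t).2
  have hslack : ∀ i j t, j ≠ i → r i (Sum.inl t) < r i (Sum.inr j) := by
    intro i j t hj
    rw [hinl, hinr, if_neg hj]
    have h1 : t.1 i ≤ N := by
      have := Finset.single_le_sum (f := t.1) (fun _ _ => Nat.zero_le _) (Finset.mem_univ i)
      rwa [hTsum t] at this
    have h2 := Nat.mul_le_mul_right M h1
    have h3 := he t
    have h4 : (N + 1) * M = N * M + M := by ring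
    omega
  have hworst : ∀ i v, r i (Sum.inr i) ≤ r i v := fun i v => by simp [hinr]
  have hpos : ∀ i t, r i (Sum.inr i) < r i (Sum.inl t) := fun i t => by
    rw [hinr, hinl, if_pos rfl]
    omega
  have hr : ∀ i, Function.Injective (r i) := by
    rintro i (t | j) (t' | j') h
    · rw [hinl, hinl] at h
      have h' := congrArg (· % M) (Nat.add_left_cancel h)
      simp only [Nat.mul_add_mod_self_right, Nat.mod_eq_of_lt (he _)] at h'
      rw [e.injective (Fin.ext h')]
    · by_cases hj : j' = i
      · subst hj
        exact absurd h (hpos j' t).ne'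
      · exact absurd h (hslack i j' t hj).ne
    · by_cases hj : j = i
      · subst hj
        exact absurd h (hpos j t').ne
      · exact absurd h (hslack i j t' hj).ne'
    · rw [hinr, hinr] at h
      split_ifs at h with h1 h2 h2
      · rw [h1, h2]
      · omega
      · omega
      · rw [eI.injective (Fin.ext (by omega : (eI j : ℕ) = eI j'))]
  have hle : ∀ i (y x : T), r i (Sum.inl y) ≤ r i (Sum.inl x) → y.1 i ≤ x.1 i := by
    intro i y x h
    by_contra hcon
    have h2 := Nat.mul_le_mul_right M (Nat.succ_le_of_lt (not_le.1 hcon))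
    have h3 := he x
    rw [hinl, hinl] at h
    rw [Nat.succ_mul] at h2
    omega
  obtain ⟨R, hR, himg⟩ :=
    exists_dominant_image_eq_univ r hr hworst hslack (fun t : T => c t.1)
  have hcol : ∀ i, Sum.inr i ∉ R → ∃ t : T, Sum.inl t ∈ R ∧ c t.1 = i := by
    intro i hi
    have : i ∈ R.image (Sum.elim (fun t : T => c t.1) id) := by
      rw [himg]
      exact Finset.mem_univ i
    obtain ⟨t | j, h, hj⟩ := Finset.mem_image.1 this
    · exact ⟨t, h, hj⟩
    · exact absurd h (by rw [show j = i from hj]; exact hi)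
  let σ : Finset T := Finset.univ.filter fun t => Sum.inl t ∈ R
  have hσ : ∀ t, t ∈ σ ↔ Sum.inl t ∈ R := fun t => by simp [σ]
  have hσne : σ.Nonempty := by
    obtain ⟨i, hi⟩ := hR (Sum.inl t₀)
    obtain ⟨t, ht, -⟩ := hcol i fun h => absurd (hi _ h) (not_le.2 (hpos i t₀))
    exact ⟨t, (hσ t).2 ht⟩
  choose w hwσ hw using fun i => σ.exists_min_image (fun t => t.1 i) hσne
  -- A lattice point above `b` would beat a member of `R` in every ranking. Dominance therefore
  -- forces `∑ i, b i` to exceed `N`.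
  let b : I → ℕ := fun i => if Sum.inr i ∈ R then 0 else (w i).1 i + 1
  have hb : N < ∑ i, b i := by
    by_contra hcon
    let y : I → ℕ := b + Pi.single i₀ (N - ∑ i, b i)
    have hy : ∑ i, y i = N := by
      simp only [y, Pi.add_apply, Finset.sum_add_distrib, Finset.sum_pi_single',
        Finset.mem_univ, if_true]
      omega
    obtain ⟨i, hi⟩ := hR (Sum.inl ⟨y, hT y hy⟩)
    by_cases hiR : Sum.inr i ∈ R
    · exact absurd (hi _ hiR) (not_le.2 (hpos i _))
    · have h1 : y i ≤ (w i).1 i := hle i ⟨y, hT y hy⟩ (w i) (hi _ ((hσ _).1 (hwσ i)))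
      have h2 : b i ≤ y i := Nat.le_add_right _ _
      simp only [b, if_neg hiR] at h2
      omega
  have hlow : ∀ t ∈ σ, ∀ i, b i ≤ t.1 i + 1 := by
    intro t ht i
    simp only [b]
    split_ifs
    · omega
    · exact Nat.succ_le_succ (hw i t ht)
  -- The numbers `t.1 j + 1` are at least `b j` and sum to `N + Fintype.card I`, less than `∑ j, b j
  -- + Fintype.card I`, so no single one can exceed its bound by `Fintype.card I`. Thus all points
  -- of `σ` are close together.
  have hupp : ∀ t ∈ σ, ∀ i, t.1 i + 1 < b i + Fintype.card I := by
    intro t ht i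
    by_contra hcon
    have h1 : ∑ j, (t.1 j + 1) = N + Fintype.card I := by
      rw [Finset.sum_add_distrib, hTsum]
      simp
    rw [← Finset.add_sum_erase _ _ (Finset.mem_univ i)] at h1 hb
    have h2 := Finset.sum_le_sum fun j (_ : j ∈ Finset.univ.erase i) => hlow t ht j
    omega
  obtain ⟨t₁, ht₁⟩ := hσne
  refine ⟨t₁.1, hTsum t₁, fun i => ?_⟩
  by_cases hi : Sum.inr i ∈ R
  · right
    have := hupp t₁ ht₁ i
    simp only [b, if_pos hi] at this
    omega
  · left
    obtain ⟨t, ht, hct⟩ := hcol i hi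
    rw [← hσ] at ht
    refine ⟨t.1, hTsum t, hct, fun j => ?_⟩
    have := hupp t ht j
    have := hlow t ht j
    have := hupp t₁ ht₁ j
    have := hlow t₁ ht₁ j
    omega

open Filter Topology in
/-- Sperner's lemma in the form of Brouwer's theorem: continuous functions `h i` on the simplex,
with `h i ≥ 0` on the `i`-th face and at every point some `h i ≥ 0`, are all `≥ 0` at some point. -/
theorem exists_forall_nonneg_of_stdSimplex {I : Type*} [Fintype I] [Nonempty I]
    (h : I → (I → ℝ) → ℝ) (hcont : ∀ i, ContinuousOn (h i) (stdSimplex ℝ I))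
    (hface : ∀ i, ∀ x ∈ stdSimplex ℝ I, x i = 0 → 0 ≤ h i x)
    (hsome : ∀ x ∈ stdSimplex ℝ I, ∃ i, 0 ≤ h i x) :
    ∃ x ∈ stdSimplex ℝ I, ∀ i, 0 ≤ h i x := by
  let m : ℝ := Fintype.card I
  have hstep : ∀ N : ℕ, ∃ z ∈ stdSimplex ℝ I, ∀ i,
      (∃ x ∈ stdSimplex ℝ I, 0 ≤ h i x ∧ dist x z ≤ m / (N + 1)) ∨ z i ≤ m / (N + 1) := by
    intro N
    have hN : (0 : ℝ) < N + 1 := by positivity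
    let s : (I → ℕ) → I → ℝ := fun x i => x i / ((N : ℝ) + 1)
    have hs : ∀ x : I → ℕ, ∑ i, x i = N + 1 → s x ∈ stdSimplex ℝ I := by
      intro x hx
      refine ⟨fun i => by positivity, ?_⟩
      simp only [s]
      rw [← Finset.sum_div, ← Nat.cast_sum, hx]
      push_cast
      exact div_self hN.ne'
    have hc : ∀ x : I → ℕ, ∃ i, ∑ i, x i = N + 1 → 0 ≤ h i (s x) := by
      intro x
      by_cases hx : ∑ i, x i = N + 1
      · exact (hsome _ (hs x hx)).imp fun i hi _ => hi
      · exact ⟨Classical.arbitrary I, fun hx' => absurd hx' hx⟩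
    choose c hc using hc
    obtain ⟨z, hz, hzi⟩ := exists_near_all_colours (N + 1) c
    refine ⟨s z, hs z hz, fun i => (hzi i).imp ?_ fun hlt => ?_⟩
    · rintro ⟨x, hx, rfl, hxz⟩
      refine ⟨s x, hs x hx, hc x hx, (dist_pi_le_iff (by positivity)).2 fun j => ?_⟩
      obtain ⟨h1, h2⟩ := hxz j
      have h1' : (x j : ℝ) ≤ z j + m := by
        simp only [m]
        exact_mod_cast h1.le
      have h2' : (z j : ℝ) ≤ x j + m := by
        simp only [m]
        exact_mod_cast h2.le
      rw [Real.dist_eq]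
      simp only [s]
      rw [← sub_div, abs_div, abs_of_pos hN]
      exact div_le_div_of_nonneg_right (abs_le.2 ⟨by linarith, by linarith⟩) hN.le
    · simp only [s, m]
      exact div_le_div_of_nonneg_right (by exact_mod_cast hlt.le) hN.le
  choose z hzmem hz using hstep
  obtain ⟨x, hx, φ, hφ, hlim⟩ := (isCompact_stdSimplex ℝ I).tendsto_subseq hzmem
  refine ⟨x, hx, fun i => ?_⟩
  -- Near `x` the function `h i` stays negative and, since `x` is off the `i`-th face, the `i`-th
  -- coordinate stays above `x i / 2`. For a fine mesh this excludes both alternatives in `hz`.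
  by_contra hneg
  push Not at hneg
  have hxi : 0 < x i := lt_of_le_of_ne (hx.1 i) fun h0 =>
    absurd (hface i x hx h0.symm) (not_le.2 hneg)
  have hsmall : Tendsto (fun k => m / ((φ k : ℝ) + 1)) atTop (𝓝 0) :=
    (tendsto_const_nhds.div_atTop (tendsto_atTop_add_const_right _ _
      (tendsto_natCast_atTop_atTop.comp hφ.tendsto_atTop)))
  obtain ⟨δ, hδ, hball⟩ := Metric.eventually_nhds_iff.1
    (eventually_nhdsWithin_iff.1 ((hcont i x hx).eventually_lt_const hneg))
  have hlimi : Tendsto (fun k => z (φ k) i) atTop (𝓝 (x i)) :=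
    ((continuous_apply i).tendsto x).comp hlim
  obtain ⟨k, hk1, hk2, hk3, hk4⟩ := ((hsmall.eventually_lt_const (half_pos hδ)).and
    ((hsmall.eventually_lt_const (half_pos hxi)).and
      ((hlimi.eventually_const_lt (half_lt_self hxi)).and
        (hlim.eventually (Metric.ball_mem_nhds x (half_pos hδ)))))).exists
  rcases hz (φ k) i with ⟨y, hy, hyi, hd⟩ | hle
  · have : dist y x < δ := by
      have h1 := dist_triangle y (z (φ k)) x
      have h2 : dist (z (φ k)) x < δ / 2 := hk4
      linarith
    exact absurd hyi (not_le.2 (hball this hy))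
  · linarith

/-- If continuous functions `ψ k` on the simplex satisfy `∑ k, x k * ψ k x ≤ 0` everywhere, then
they are simultaneously `≤ 0` at some point. -/
theorem exists_forall_nonpos_of_sum_mul_nonpos {I : Type*} [Fintype I] [Nonempty I]
    (ψ : I → (I → ℝ) → ℝ) (hcont : ∀ i, ContinuousOn (ψ i) (stdSimplex ℝ I))
    (hsum : ∀ x ∈ stdSimplex ℝ I, ∑ i, x i * ψ i x ≤ 0) :
    ∃ x ∈ stdSimplex ℝ I, ∀ i, ψ i x ≤ 0 := by
  let S : (I → ℝ) → ℝ := fun x => ∑ i, max (ψ i x) 0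
  have hScont : ContinuousOn S (stdSimplex ℝ I) :=
    continuousOn_finsetSum _ fun i _ => (hcont i).sup continuousOn_const
  -- These functions, from Nash's fixed point map, sum to zero on the simplex, so some one is
  -- nonnegative. Where all are and `S x > 0`, positive weights force positive `ψ i x`,
  -- contradicting `hsum`.
  obtain ⟨x, hx, hnn⟩ := exists_forall_nonneg_of_stdSimplex
    (fun i x => max (ψ i x) 0 - x i * S x)
    (fun i => ((hcont i).sup continuousOn_const).sub
      ((continuous_apply i).continuousOn.mul hScont))
    (fun i x _ h0 => by simp [h0])
    (fun x hx => by
      by_contra hcon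
      push Not at hcon
      have := Finset.sum_lt_sum_of_nonempty Finset.univ_nonempty fun i _ => hcon i
      simp only [Finset.sum_sub_distrib, ← Finset.sum_mul, hx.2, S] at this
      simp at this)
  refine ⟨x, hx, ?_⟩
  have hS0 : 0 ≤ S x := Finset.sum_nonneg fun i _ => le_max_right _ _
  rcases hS0.eq_or_lt with hS | hS
  · intro i
    have := (Finset.sum_eq_zero_iff_of_nonneg fun i _ => le_max_right (ψ i x) 0).1 hS.symm i
      (Finset.mem_univ i)
    exact max_eq_right_iff.1 this
  · exfalso
    have hpos : ∀ i, 0 < x i → 0 < ψ i x := by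
      intro i hi
      by_contra hcon
      have := hnn i
      rw [max_eq_right (not_lt.1 hcon)] at this
      linarith [mul_pos hi hS]
    have hterm : ∀ i ∈ Finset.univ, 0 ≤ x i * ψ i x := by
      intro i _
      rcases (hx.1 i).eq_or_lt with h0 | h0
      · simp [← h0]
      · exact (mul_pos h0 (hpos i h0)).le
    obtain ⟨i, hi⟩ : ∃ i, 0 < x i := by
      by_contra hcon
      push Not at hcon
      have := hx.2
      linarith [Finset.sum_nonpos fun i (_ : i ∈ Finset.univ) => hcon i]
    have := Finset.single_le_sum hterm (Finset.mem_univ i)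
    linarith [hsum x hx, mul_pos hi (hpos i hi)]

end Sperner

/-! ### Weak closedness, weak continuity and weak compactness. -/

section WeakTopology

variable {E : Type*} [NormedAddCommGroup E] [NormedSpace ℝ E]

theorem isWeaklyClosed_iff {S : Set E} :
    IsWeaklyClosed S ↔ IsClosed ((toWeakSpace ℝ E).symm ⁻¹' S) := by
  rw [IsWeaklyClosed, LinearEquiv.image_eq_preimage_symm]

theorem WeaklyContinuousOn.isWeaklyClosed {g : E → ℝ} {X : Set E} (hg : WeaklyContinuousOn g X) :
    IsWeaklyClosed X := by
  -- `X` is the union of `{g ≤ 0}` and `{-g ≤ 0}`.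
  have h := (isWeaklyClosed_iff.1 (hg.1 0)).union (isWeaklyClosed_iff.1 (hg.2 0))
  rw [isWeaklyClosed_iff]
  convert h using 1
  ext x
  simp only [Set.mem_preimage, Set.mem_union, Set.mem_ofPred_eq, ← and_or_left, Left.neg_nonpos_iff]
  exact ⟨fun hx => ⟨hx, le_total _ _⟩, fun hx => hx.1⟩

theorem WeaklyContinuousOn.continuousOn {g : E → ℝ} {X : Set E} (hg : WeaklyContinuousOn g X) :
    ContinuousOn (fun x => g ((toWeakSpace ℝ E).symm x)) ((toWeakSpace ℝ E).symm ⁻¹' X) := by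
  have key : ∀ {g : E → ℝ}, WeaklyLowerSemicontinuousOn g X →
      LowerSemicontinuous (((toWeakSpace ℝ E).symm ⁻¹' X).domRestrict
        fun x => g ((toWeakSpace ℝ E).symm x)) := by
    intro g hg
    rw [lowerSemicontinuous_iff_isClosed_preimage]
    intro l
    convert (isWeaklyClosed_iff.1 (hg l)).preimage continuous_subtype_val using 1
    ext x
    exact ⟨fun h => ⟨x.2, h⟩, fun h => h.2⟩
  rw [continuousOn_iff_continuous_domRestrict, continuous_iff_lower_upperSemicontinuous]
  refine ⟨key hg.1, ?_⟩
  have h := (key hg.2)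
  intro x l hl
  filter_upwards [h x (-l) (neg_lt_neg hl)] with y hy using neg_lt_neg_iff.1 hy

/-- In a reflexive space, bounded weakly closed sets are weakly compact. -/
theorem IsReflexiveSpace.isCompact (hE : IsReflexiveSpace E) {S : Set E} (hS : IsWeaklyClosed S)
    (hb : Bornology.IsBounded S) : IsCompact ((toWeakSpace ℝ E).symm ⁻¹' S) := by
  rw [isWeaklyClosed_iff] at hS
  rw [← hS.closure_eq]
  refine NormedSpace.isCompact_closure_of_isBounded ℝ E _ ?_ ?_
  · exact hb
  · intro Φ _
    obtain ⟨x, hx⟩ := hE Φ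
    exact ⟨toWeakSpace ℝ E x, hx⟩

end WeakTopology

/-! ### Reflexivity of the finite product. -/

section Product

variable {ι : Type*} [DecidableEq ι] {E : ι → Type*} [∀ i, NormedAddCommGroup (E i)]
  [∀ i, NormedSpace ℝ (E i)]

/-- The inclusion of a factor into the product, as a continuous linear map. -/
noncomputable def singlePiLp (i : ι) : E i →L[ℝ] PiLp 2 E :=
  (PiLp.continuousLinearEquiv 2 ℝ E).symm.toContinuousLinearMap ∘L ContinuousLinearMap.single ℝ E i

theorem singlePiLp_apply (i j : ι) (x : E i) :
    singlePiLp i x j = (Pi.single i x : ∀ j, E j) j := rfl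

variable [Fintype ι]

theorem sum_singlePiLp (x : PiLp 2 E) : ∑ i, singlePiLp i (x i) = x := by
  ext j
  rw [WithLp.ofLp_sum, Finset.sum_apply]
  simp only [singlePiLp_apply]
  rw [Finset.sum_eq_single j (fun i _ hi => Pi.single_eq_of_ne hi.symm _) (by simp),
    Pi.single_eq_same]

theorem IsReflexiveSpace.piLp (hE : ∀ i, IsReflexiveSpace (E i)) :
    IsReflexiveSpace (PiLp 2 E) := by
  intro Φ
  -- The `i`-th coordinate represents the restriction of `Φ` to functionals that factor through the
  -- `i`-th projection; every functional is a sum of such.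
  choose x hx using fun i =>
    hE i (Φ ∘L (ContinuousLinearMap.compL ℝ (PiLp 2 E) (E i) ℝ).flip (PiLp.proj 2 E i))
  refine ⟨WithLp.toLp 2 x, ?_⟩
  ext l
  have hl : l = ∑ i, (l ∘L singlePiLp i) ∘L PiLp.proj 2 E i := by
    ext y
    rw [sum_apply]
    conv_lhs => rw [← sum_singlePiLp y]
    rw [map_sum]
    rfl
  rw [NormedSpace.dual_def]
  conv_rhs => rw [hl, map_sum]
  conv_lhs => rw [← sum_singlePiLp (WithLp.toLp 2 x), map_sum]
  refine Finset.sum_congr rfl fun i _ => ?_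
  have := DFunLike.congr_fun (hx i) (l ∘L singlePiLp i)
  rw [NormedSpace.dual_def] at this
  exact this

end Product

/-! ### Ky Fan's inequality. -/

section KyFan

variable {W : Type*} [AddCommGroup W] [Module ℝ W] [TopologicalSpace W] [IsTopologicalAddGroup W]
  [ContinuousSMul ℝ W]

/-- A finite form of Ky Fan's minimax inequality. -/
theorem exists_forall_nonpos_of_finite {X : Set W} (hX : Convex ℝ X) {φ : W → W → ℝ}
    (hdiag : ∀ p ∈ X, φ p p ≤ 0) (hcont : ∀ p ∈ X, ContinuousOn (fun q => φ q p) X)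
    (hconc : ∀ q ∈ X, ConcaveOn ℝ X (φ q)) {I : Type*} [Fintype I] [Nonempty I] (p : I → W)
    (hp : ∀ i, p i ∈ X) : ∃ q ∈ X, ∀ i, φ q (p i) ≤ 0 := by
  have hmem : ∀ x ∈ stdSimplex ℝ I, ∑ i, x i • p i ∈ X := fun x hx =>
    hX.sum_mem (fun i _ => hx.1 i) hx.2 fun i _ => hp i
  -- With `q` the barycentre of the `p i` with weights `x`, concavity gives `∑ i, x i * φ q (p i) ≤
  -- φ q q ≤ 0`.
  obtain ⟨x, hx, h⟩ := exists_forall_nonpos_of_sum_mul_nonpos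
    (fun i x => φ (∑ j, x j • p j) (p i))
    (fun i => (hcont _ (hp i)).comp (by fun_prop) hmem)
    (fun x hx => ((hconc _ (hmem x hx)).le_map_sum (fun i _ => hx.1 i) hx.2
      fun i _ => hp i).trans (hdiag _ (hmem x hx)))
  exact ⟨_, hmem x hx, h⟩

/-- **Ky Fan's minimax inequality**, with a coercivity condition instead of compactness. -/
theorem exists_forall_nonpos_of_isCompact {X : Set W} (hX : Convex ℝ X) (hXc : IsClosed X)
    {φ : W → W → ℝ} (hdiag : ∀ p ∈ X, φ p p ≤ 0)
    (hcont : ∀ p ∈ X, ContinuousOn (fun q => φ q p) X)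
    (hconc : ∀ q ∈ X, ConcaveOn ℝ X (φ q)) {p₀ : W} (hp₀ : p₀ ∈ X)
    (hcomp : IsCompact {q | q ∈ X ∧ φ q p₀ ≤ 0}) : ∃ q ∈ X, ∀ p ∈ X, φ q p ≤ 0 := by
  obtain ⟨q, hq, hall⟩ := hcomp.inter_iInter_nonempty (fun p : X => {q | q ∈ X ∧ φ q p ≤ 0})
    (fun p => (hcont p p.2).preimage_isClosed_of_isClosed hXc isClosed_Iic) fun u => by
      obtain ⟨q, hq, h⟩ := exists_forall_nonpos_of_finite hX hdiag hcont hconc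
        -- The extra index `none` adds `p₀` to the finite family, so that the point found lies in
        -- the compact set.
        (fun k : Option u => k.elim p₀ fun p => (p : X))
        (fun k => by
          cases k with
          | none => exact hp₀
          | some p => exact p.1.2)
      exact ⟨q, ⟨hq, h none⟩, Set.mem_iInter₂.2 fun p hp => ⟨hq, h (some ⟨p, hp⟩)⟩⟩
  exact ⟨q, hq.1, fun p hp => (Set.mem_iInter.1 hall ⟨p, hp⟩).2⟩

end KyFan

/-! ### Unilateral deviations and the Nikaido–Isoda function. -/

section Nash

variable {n : ℕ} {E : Fin n → Type*}

theorem deviate_self (q : PiLp 2 E) (i : Fin n) : deviate q i (q i) = q := by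
  ext j
  simp [deviate]

theorem deviate_apply_self (q : PiLp 2 E) (i : Fin n) (x : E i) : deviate q i x i = x := by
  simp [deviate]

theorem deviate_apply_of_ne (q : PiLp 2 E) {i j : Fin n} (h : j ≠ i) (x : E i) :
    deviate q i x j = q j := by
  simp [deviate, h]

theorem deviate_mem {K : ∀ i, Set (E i)} {q : PiLp 2 E} (hq : q ∈ strategyProfiles K) {i : Fin n}
    {x : E i} (hx : x ∈ K i) : deviate q i x ∈ strategyProfiles K := by
  intro j
  by_cases h : j = i
  · subst h
    rwa [deviate_apply_self]
  · rw [deviate_apply_of_ne q h]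
    exact hq j

/-- The Nikaido–Isoda function: the total gain of the players when each of them deviates
alone from `q` to its strategy in `p`. -/
def nikaidoIsoda (f : Fin n → PiLp 2 E → ℝ) (q p : PiLp 2 E) : ℝ :=
  ∑ i, (f i q - f i (deviate q i (p i)))

theorem nikaidoIsoda_self (f : Fin n → PiLp 2 E → ℝ) (q : PiLp 2 E) :
    nikaidoIsoda f q q = 0 := by
  simp [nikaidoIsoda, deviate_self]

theorem nikaidoIsoda_deviate (f : Fin n → PiLp 2 E → ℝ) (q : PiLp 2 E) (i : Fin n) (x : E i) :
    nikaidoIsoda f q (deviate q i x) = f i q - f i (deviate q i x) := by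
  rw [nikaidoIsoda, Finset.sum_eq_single i, deviate_apply_self]
  · intro j _ hj
    rw [deviate_apply_of_ne q hj, deviate_self, sub_self]
  · simp

theorem isNashEquilibrium_of_nikaidoIsoda_nonpos {K : ∀ i, Set (E i)} {f : Fin n → PiLp 2 E → ℝ}
    {q : PiLp 2 E} (hq : q ∈ strategyProfiles K)
    (h : ∀ p ∈ strategyProfiles K, nikaidoIsoda f q p ≤ 0) : IsNashEquilibrium K f q := by
  refine ⟨hq, fun i => ⟨⟨q i, hq i, ?_⟩, ?_⟩⟩
  · exact congrArg (f i) (deviate_self q i)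
  · rintro _ ⟨x, hx, rfl⟩
    have := h _ (deviate_mem hq hx)
    rw [nikaidoIsoda_deviate] at this
    exact sub_nonpos.1 this

variable [∀ i, NormedAddCommGroup (E i)] [∀ i, NormedSpace ℝ (E i)]

/-- Exhibits a deviation to a fixed strategy as a bounded linear map plus a constant, which makes it
weakly continuous in `q`. -/
theorem deviate_eq (q : PiLp 2 E) (i : Fin n) (x : E i) :
    deviate q i x =
      (ContinuousLinearMap.id ℝ (PiLp 2 E) - singlePiLp i ∘L PiLp.proj 2 E i) q +
        singlePiLp i x := by
  ext j
  change _ = q j - singlePiLp i (q i) j + singlePiLp i x j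
  rw [singlePiLp_apply, singlePiLp_apply]
  by_cases h : j = i
  · subst h
    simp [deviate_apply_self]
  · simp [deviate_apply_of_ne q h, h]

theorem continuous_deviate_weakSpace (i : Fin n) (x : E i) :
    Continuous fun q : WeakSpace ℝ (PiLp 2 E) =>
      toWeakSpace ℝ (PiLp 2 E) (deviate ((toWeakSpace ℝ (PiLp 2 E)).symm q) i x) := by
  simp only [deviate_eq, map_add]
  exact (WeakSpace.map (ContinuousLinearMap.id ℝ (PiLp 2 E) -
    singlePiLp i ∘L PiLp.proj 2 E i)).continuous.add continuous_const

theorem convex_strategyProfiles {K : ∀ i, Set (E i)} (hK : ∀ i, Convex ℝ (K i)) :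
    Convex ℝ (strategyProfiles K) :=
  fun _ hp _ hq _ _ ha hb hab i => hK i (hp i) (hq i) ha hb hab

theorem concaveOn_nikaidoIsoda {K : ∀ i, Set (E i)} (hK : ∀ i, Convex ℝ (K i))
    {f : Fin n → PiLp 2 E → ℝ} {q : PiLp 2 E}
    (hconv : ∀ i, ConvexOn ℝ (K i) (fun x => f i (deviate q i x))) :
    ConcaveOn ℝ (strategyProfiles K) (nikaidoIsoda f q) := by
  refine ⟨convex_strategyProfiles hK, fun p hp p' hp' a b ha hb hab => ?_⟩
  simp only [nikaidoIsoda, smul_eq_mul, Finset.mul_sum, ← Finset.sum_add_distrib]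
  refine Finset.sum_le_sum fun i _ => ?_
  have := (hconv i).2 (hp i) (hp' i) ha hb hab
  simp only [smul_eq_mul] at this
  have h1 : (a • p + b • p') i = a • p i + b • p' i := rfl
  rw [h1]
  have h2 : a * f i q + b * f i q = f i q := by rw [← add_mul, hab, one_mul]
  linarith

theorem continuousOn_nikaidoIsoda {K : ∀ i, Set (E i)} {f : Fin n → PiLp 2 E → ℝ}
    (hcont : ∀ i, WeaklyContinuousOn (f i) (strategyProfiles K)) {p : PiLp 2 E}
    (hp : p ∈ strategyProfiles K) :
    ContinuousOn (fun q => nikaidoIsoda f ((toWeakSpace ℝ (PiLp 2 E)).symm q) p)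
      ((toWeakSpace ℝ (PiLp 2 E)).symm ⁻¹' strategyProfiles K) := by
  refine continuousOn_finsetSum _ fun i _ => (hcont i).continuousOn.sub ?_
  exact (hcont i).continuousOn.comp (continuous_deviate_weakSpace i (p i)).continuousOn
    fun q hq => deviate_mem hq (hp i)

end Nash

theorem mainTheorem2 {n : ℕ} {E : Fin n → Type*}
    [∀ i, NormedAddCommGroup (E i)] [∀ i, NormedSpace ℝ (E i)] [∀ i, CompleteSpace (E i)]
    (hE : ∀ i, IsReflexiveSpace (E i))
    (K : ∀ i, Set (E i)) (hKne : ∀ i, (K i).Nonempty) (hKconv : ∀ i, Convex ℝ (K i))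
    (f : Fin n → PiLp 2 E → ℝ)
    (hconv : ∀ i, ∀ p ∈ strategyProfiles K, ConvexOn ℝ (K i) (fun x => f i (deviate p i x)))
    (hcont : ∀ i, WeaklyContinuousOn (f i) (strategyProfiles K))
    (hbdd : ∃ p₀ ∈ strategyProfiles K, Bornology.IsBounded
      {q : PiLp 2 E | q ∈ strategyProfiles K ∧
        ∑ i, (f i q - f i (deviate q i (p₀ i))) ≤ 0}) :
    ∃ q : PiLp 2 E, IsNashEquilibrium K f q := by
  obtain ⟨p₀, hp₀, hb⟩ := hbdd
  -- Weak closedness of the profile set is read off from the loss of some player, so the game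
  -- without players is settled separately.
  rcases isEmpty_or_nonempty (Fin n) with hn | ⟨⟨i₀⟩⟩
  · exact ⟨p₀, hp₀, fun i => hn.elim i⟩
  let e := toWeakSpace ℝ (PiLp 2 E)
  have hX := isWeaklyClosed_iff.1 (hcont i₀).isWeaklyClosed
  have hclosed : IsWeaklyClosed {q | q ∈ strategyProfiles K ∧ nikaidoIsoda f q p₀ ≤ 0} :=
    isWeaklyClosed_iff.2
      ((continuousOn_nikaidoIsoda hcont hp₀).preimage_isClosed_of_isClosed hX isClosed_Iic)
  obtain ⟨q, hq, h⟩ := exists_forall_nonpos_of_isCompact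
    (φ := fun q p => nikaidoIsoda f (e.symm q) (e.symm p))
    ((convex_strategyProfiles hKconv).linear_preimage e.symm.toLinearMap) hX
    (fun q _ => (nikaidoIsoda_self f _).le)
    (fun p hp => continuousOn_nikaidoIsoda hcont hp)
    (fun q hq => (concaveOn_nikaidoIsoda hKconv fun i => hconv i _ hq).comp_linearMap
      e.symm.toLinearMap)
    (p₀ := e p₀) hp₀ ((IsReflexiveSpace.piLp hE).isCompact hclosed hb)
  exact ⟨e.symm q, isNashEquilibrium_of_nikaidoIsoda_nonpos hq fun p hp => h (e p) hp⟩
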